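/- For a probability measure $\mu$ on $\mathbb{R}$ that is infinitely divisible (written $\mu\in ID(\mathbb{R})$), let $\phi$ be its characteristic exponent, that is, the unique continuous function $\phi:\mathbb{R}\to\mathbb{C}$ with $\phi(0)=0$ and $\int_{\mathbb{R}} e^{izx}\,\mu(dx)=e^{\phi(z)}$ for all $z\in\mathbb{R}$, and for $s\ge 0$ let $\mu^{s}$ be the probability measure with characteristic function $z\mapsto e^{s\phi(z)}$. Let $\mathfrak{M}_L(\mathbb{R})$ be the class of Lévy measures on $\mathbb{R}$, i.e. of the $\sigma$-finite Borel measures $\rho$ with $\rho(\{0\})=0$ and $\int_{\mathbb{R}}(1\wedge|x|^2)\,\rho(dx)<\infty$; let $\mathfrak{M}_L(\mathbb{R}^+)$ be the class of Lévy measures concentrated on $(0,\infty)$, and let $\mathfrak{M}_L^1(\mathbb{R}^+)$ be the class of those $\rho\in\mathfrak{M}_L(\mathbb{R}^+)$ with $\int_0^\infty(1\wedge s)\,\rho(ds)<\infty$. For $\rho\in\mathfrak{M}_L(\mathbb{R}^+)$ define the measure $\Phi_\mu(\rho)$ on $\mathbb{R}$ by $$\Phi_\mu(\rho)(A)=\int_0^\infty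 \mu^{s}(A)\,\rho(ds),\quad A\in\mathcal{B}(\mathbb{R}\setminus\{0\}),\qquad \Phi_\mu(\rho)(\{0\})=0,$$ and put $$\mathcal{D}_L(\Phi_\mu)=\{\rho\in\mathfrak{M}_L(\mathbb{R}^+):\Phi_\mu(\rho)\in\mathfrak{M}_L(\mathbb{R})\},\qquad \mathcal{R}_L(\Phi_\mu)=\{\Phi_\mu(\rho):\rho\in\mathcal{D}_L(\Phi_\mu)\}.$$ Proposition. Let $\mu\in ID(\mathbb{R})$. Then 1. $\mathcal{D}_L(\Phi_\mu)=\mathfrak{M}_L^1(\mathbb{R}^+)$ provided that $\mu$ is not a Dirac measure; 2. $\mathcal{R}_L(\Phi_\mu)\subsetneq\mathfrak{M}_L(\mathbb{R})$ (for every $\mu\in ID(\mathbb{R})$, Dirac measures included). -/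

import Mathlib

open MeasureTheory

namespace LevyMixing

/-- The `n`-fold convolution of `κ` with itself. -/
noncomputable def nFoldConv (κ : Measure ℝ) : ℕ → Measure ℝ
  | 0 => Measure.dirac 0
  | n + 1 => Measure.conv (nFoldConv κ n) κ

/-- `μ ∈ ID(ℝ)`: `μ` is a probability measure that for every `n ≥ 1` is the `n`-fold convolution
of some probability measure with itself. -/
def InfinitelyDivisible (μ : Measure ℝ) : Prop :=
  IsProbabilityMeasure μ ∧
    ∀ n : ℕ, 1 ≤ n → ∃ κ : Measure ℝ, IsProbabilityMeasure κ ∧ nFoldConv κ n = μ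

/-- `φ` is the characteristic exponent (distinguished logarithm of the characteristic function)
of `μ`: the continuous function with `φ 0 = 0` and `exp (φ z) = ∫ exp (i z x) μ(dx)`. There is at
most one such function, and there is one whenever the characteristic function has no zero. -/
def IsCharExponent (μ : Measure ℝ) (φ : ℝ → ℂ) : Prop :=
  Continuous φ ∧ φ 0 = 0 ∧ ∀ z : ℝ, charFun μ z = Complex.exp (φ z)

/-- `κ` is the convolution power `μ ^ s`: the probability measure with characteristic function
`z ↦ exp (s φ(z))`, where `φ` is the characteristic exponent of `μ`. -/
def IsConvPow (μ : Measure ℝ) (s : ℝ) (κ : Measure ℝ) : Prop :=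
  IsProbabilityMeasure κ ∧
    ∃ φ : ℝ → ℂ, IsCharExponent μ φ ∧ ∀ z : ℝ, charFun κ z = Complex.exp ((s : ℂ) * φ z)

open Classical in
/-- The convolution power `μ ^ s`, i.e. the law at time `s` of the Lévy process whose law at time
`1` is `μ`. A measure is determined by its characteristic function, so that there is at most one
candidate; for `μ` infinitely divisible and `s ≥ 0` there is one. The value is `0` if there is no
candidate. -/
noncomputable def convPow (μ : Measure ℝ) (s : ℝ) : Measure ℝ :=
  if h : ∃ κ : Measure ℝ, IsConvPow μ s κ then h.choose else 0

/-- `ρ` is a Lévy measure on `ℝ`. -/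
structure IsLevyMeasure (ρ : Measure ℝ) : Prop where
  sigmaFinite : SigmaFinite ρ
  zero : ρ {0} = 0
  lintegral_lt_top : ∫⁻ x, ENNReal.ofReal (min 1 (|x| ^ 2)) ∂ρ < ⊤

/-- The class `M_L(ℝ)` of Lévy measures on `ℝ`. -/
def levyMeasures : Set (Measure ℝ) :=
  {ρ | IsLevyMeasure ρ}

/-- The class `M_L(ℝ⁺)` of Lévy measures on `ℝ⁺`, seen as the Lévy measures on `ℝ` that are
concentrated on `(0, ∞)`. -/
def levyMeasuresPos : Set (Measure ℝ) :=
  {ρ | IsLevyMeasure ρ ∧ ρ (Set.Iic 0) = 0}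

/-- The class `M_L^1(ℝ⁺)` of Lévy measures `ρ` on `ℝ⁺` with `∫ (1 ∧ |s|) ρ(ds) < ∞`. -/
def levyMeasuresPosOne : Set (Measure ℝ) :=
  {ρ | ρ ∈ levyMeasuresPos ∧ ∫⁻ s, ENNReal.ofReal (min 1 |s|) ∂ρ < ⊤}

/-- The Lévy mixing map `Φ_μ`: the measure `Φ_μ(ρ)` has no mass at `0`, and
`Φ_μ(ρ)(A) = ∫ μ^s(A) ρ(ds)` for Borel sets `A` that do not contain `0`. -/
noncomputable def mixing (μ ρ : Measure ℝ) : Measure ℝ :=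
  (ρ.bind (convPow μ)).restrict {0}ᶜ

/-- The Lévy domain of `Φ_μ`. -/
def levyDomain (μ : Measure ℝ) : Set (Measure ℝ) :=
  {ρ | ρ ∈ levyMeasuresPos ∧ mixing μ ρ ∈ levyMeasures}

/-- The range of `Φ_μ`. -/
def levyRange (μ : Measure ℝ) : Set (Measure ℝ) :=
  mixing μ '' levyDomain μ

end LevyMixing

/-! By Tonelli, `∫ (1 ∧ x²) dΦ_μ(ρ) = ∫ g(s) ρ(ds)` with `g(s) = ∫ (1 ∧ x²) dμ^s`, so the first
claim holds once `g(s)` is comparable to `1 ∧ s`. Averaging `1 - exp (s φ)` over `[-1, 1]` bounds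
`g` above (`exists_integral_min_one_sq_le`). For the lower bound (`exists_min_one_le`), a non-Dirac
`μ` has some `z` with `Re φ(z) < 0`, and `1 - exp (s Re φ(z)) ≤ (2 + z²) g(s)`.

For the second claim, `δ₁ + δ₋₁` is never attained. If it were `Φ_μ(ρ)`, some `μ^s` with `s > 0`
would live on `[-1, 1]`, which forces `μ = δ_a` (`eq_dirac_of_bounded_convPow`). Then every `μ^s =
δ_{sa}` lies on the same side of the origin, and the mixture cannot charge both half-lines. -/

namespace LevyMixing

open Filter Topology

/-! ### Symmetrization and degenerate laws -/

section CharFun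

variable (κ : Measure ℝ) [IsProbabilityMeasure κ]

lemma nFoldConv_isProbabilityMeasure (n : ℕ) : IsProbabilityMeasure (nFoldConv κ n) := by
  induction n with
  | zero => exact inferInstanceAs (IsProbabilityMeasure (Measure.dirac 0))
  | succ n ih => exact inferInstanceAs (IsProbabilityMeasure (Measure.conv (nFoldConv κ n) κ))

lemma charFun_nFoldConv (n : ℕ) (z : ℝ) : charFun (nFoldConv κ n) z = charFun κ z ^ n := by
  induction n with
  | zero => simp [nFoldConv, charFun_dirac]
  | succ n ih =>
    have := nFoldConv_isProbabilityMeasure κ n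
    rw [nFoldConv, charFun_conv, ih, pow_succ]

lemma integrable_cos_mul (z : ℝ) : Integrable (fun x ↦ Real.cos (z * x)) κ :=
  Integrable.of_bound (by fun_prop) 1 (ae_of_all _ fun x ↦ by
    simpa using Real.abs_cos_le_one (z * x))

lemma re_charFun (z : ℝ) : (charFun κ z).re = ∫ x, Real.cos (z * x) ∂κ := by
  have hint : Integrable (fun x : ℝ ↦ Complex.exp (z * x * Complex.I)) κ :=
    Integrable.of_bound (by fun_prop) 1 (ae_of_all _ fun x ↦ by
      have := Complex.norm_exp_ofReal_mul_I (z * x)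
      push_cast at this
      exact this.le)
  rw [charFun_apply_real]
  have := (integral_re hint).symm
  simp only [RCLike.re_to_complex] at this
  rw [this]
  congr 1
  ext x
  have := Complex.exp_ofReal_mul_I_re (z * x)
  push_cast at this
  exact this

lemma one_sub_re_charFun (z : ℝ) :
    1 - (charFun κ z).re = ∫ x, (1 - Real.cos (z * x)) ∂κ := by
  rw [integral_sub (integrable_const _) (integrable_cos_mul κ z), re_charFun]
  simp

/-- The law of `X - Y` for independent `X` and `Y` of law `κ`. -/
noncomputable def symmetrization : Measure ℝ :=
  Measure.conv κ (κ.map (fun x ↦ (-1 : ℝ) * x))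

instance map_neg_isProbabilityMeasure : IsProbabilityMeasure (κ.map (fun x ↦ (-1 : ℝ) * x)) :=
  Measure.isProbabilityMeasure_map (by fun_prop)

instance symmetrization_isProbabilityMeasure : IsProbabilityMeasure (symmetrization κ) :=
  inferInstanceAs (IsProbabilityMeasure (Measure.conv κ _))

lemma charFun_symmetrization (z : ℝ) :
    charFun (symmetrization κ) z = ((‖charFun κ z‖ ^ 2 : ℝ) : ℂ) := by
  rw [symmetrization, charFun_conv, charFun_map_mul, neg_one_mul, charFun_neg, Complex.mul_conj,
    Complex.normSq_eq_norm_sq]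

/-- Symmetrizing makes the squared modulus a cosine integral; then `1 - cos 2t = 2 (1 - cos t) (1 +
cos t) ≤ 4 (1 - cos t)`. -/
lemma one_sub_sq_norm_charFun_two_mul_le (z : ℝ) :
    1 - ‖charFun κ (2 * z)‖ ^ 2 ≤ 4 * (1 - ‖charFun κ z‖ ^ 2) := by
  have h (w : ℝ) : 1 - ‖charFun κ w‖ ^ 2 = ∫ x, (1 - Real.cos (w * x)) ∂(symmetrization κ) := by
    rw [← one_sub_re_charFun, charFun_symmetrization, Complex.ofReal_re]
  rw [h, h, ← integral_const_mul]
  refine integral_mono ((integrable_const _).sub (integrable_cos_mul _ _))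
    (((integrable_const _).sub (integrable_cos_mul _ _)).const_mul _) fun x ↦ ?_
  dsimp only
  rw [mul_assoc, Real.cos_two_mul]
  nlinarith [sq_nonneg (1 - Real.cos (z * x))]

lemma eq_dirac_of_measure_compl_singleton {a : ℝ} (h : κ {a}ᶜ = 0) : κ = Measure.dirac a := by
  refine Measure.ext_of_charFun (funext fun z ↦ ?_)
  have : ∀ᵐ x : ℝ ∂κ, Complex.exp (z * x * Complex.I) = Complex.exp (z * a * Complex.I) := by
    filter_upwards [compl_mem_ae_iff.mpr h] with x hx
    simp only [compl_compl, Set.mem_singleton_iff] at hx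
    rw [hx]
  rw [charFun_apply_real, integral_congr_ae this, charFun_apply_real]
  simp

/-- The symmetrized law is `δ₀`, so independent copies satisfy `X = Y` almost surely; fixing one
typical value of `X` pins down `Y`. -/
lemma exists_eq_dirac_of_norm_charFun_eq_one (h : ∀ z, ‖charFun κ z‖ = 1) :
    ∃ a : ℝ, κ = Measure.dirac a := by
  have hd : symmetrization κ = Measure.dirac 0 := by
    refine Measure.ext_of_charFun (funext fun z ↦ ?_)
    rw [charFun_symmetrization, h, charFun_dirac]
    simp
  have h0 : symmetrization κ {0}ᶜ = 0 := by simp [hd]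
  rw [← lintegral_indicator_one (by measurability), symmetrization,
    Measure.lintegral_conv (by fun_prop (disch := measurability)),
    lintegral_eq_zero_iff (by
      apply Measurable.lintegral_prod_right
      exact (measurable_one.indicator (by measurability)).comp measurable_add)] at h0
  obtain ⟨x, hx⟩ := h0.exists
  refine ⟨x, eq_dirac_of_measure_compl_singleton κ ?_⟩
  simp only [Pi.zero_apply] at hx
  rw [lintegral_map (f := fun y ↦ ({0}ᶜ : Set ℝ).indicator 1 (x + y))
    ((measurable_one.indicator (by measurability)).comp (measurable_const_add x))
    (by fun_prop)] at hx
  rw [← lintegral_indicator_one (by measurability), ← hx]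
  congr 1
  ext y
  by_cases hy : y = x
  · simp [hy]
  · have : ¬ x + -y = 0 := fun h ↦ hy (by linarith)
    simp [hy, this]

end CharFun

/-! ### Characteristic exponent and existence of convolution powers -/

section Exponent

lemma exists_continuous_log {g : ℝ → ℂ} (hg : Continuous g) (h0 : g 0 = 1) (hz : ∀ z, g z ≠ 0) :
    ∃ φ : ℝ → ℂ, Continuous φ ∧ φ 0 = 0 ∧ ∀ z, g z = Complex.exp (φ z) := by
  obtain ⟨F, ⟨hF0, hF⟩, -⟩ := Complex.isCoveringMapOn_exp.existsUnique_continuousMap_lifts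
    ⟨g, hg⟩ (a₀ := 0) (e₀ := 0) (by simp [h0]) (fun z ↦ hz z)
  exact ⟨F, F.continuous, hF0, fun z ↦ (congr_fun hF z).symm⟩

lemma continuous_log_unique {φ ψ : ℝ → ℂ} (hφ : Continuous φ) (hψ : Continuous ψ)
    (h0 : φ 0 = ψ 0) (h : ∀ z, Complex.exp (φ z) = Complex.exp (ψ z)) : φ = ψ :=
  Complex.isCoveringMap_exp.eq_of_comp_eq hφ hψ
    (funext fun z ↦ Subtype.ext (h z)) 0 h0

lemma IsCharExponent.unique {μ : Measure ℝ} {φ ψ : ℝ → ℂ} (hφ : IsCharExponent μ φ)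
    (hψ : IsCharExponent μ ψ) : φ = ψ :=
  continuous_log_unique hφ.1 hψ.1 (hφ.2.1.trans hψ.2.1.symm)
    fun z ↦ (hφ.2.2 z).symm.trans (hψ.2.2 z)

variable {μ : Measure ℝ}

/-- A zero at `2z` is also a zero of each `n`-th root, whose squared modulus at `z` is then at most
`3/4`. Hence `‖charFun μ z‖ ^ 2 ≤ (3/4)^n` for all `n ≥ 1`, which contradicts `hz`. -/
lemma InfinitelyDivisible.charFun_two_mul_ne_zero (hμ : InfinitelyDivisible μ) {z : ℝ}
    (hz : charFun μ z ≠ 0) : charFun μ (2 * z) ≠ 0 := by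
  intro h2
  set c := ‖charFun μ z‖ ^ 2 with hc
  have hc0 : 0 < c := by positivity
  have hlim : Tendsto (fun n : ℕ ↦ (3 / 4 : ℝ) ^ n) atTop (𝓝 0) :=
    tendsto_pow_atTop_nhds_zero_of_lt_one (by norm_num) (by norm_num)
  obtain ⟨n, hn, hn1⟩ := ((hlim.eventually_lt_const hc0).and (eventually_ge_atTop 1)).exists
  obtain ⟨κ, hκ, rfl⟩ := hμ.2 n hn1
  rw [charFun_nFoldConv, pow_eq_zero_iff (by omega)] at h2
  have h := one_sub_sq_norm_charFun_two_mul_le κ z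
  rw [h2] at h
  have h34 : ‖charFun κ z‖ ^ 2 ≤ 3 / 4 := by
    simp only [norm_zero] at h
    linarith
  have : c ≤ (3 / 4 : ℝ) ^ n := by
    rw [hc, charFun_nFoldConv, norm_pow, ← pow_mul, mul_comm, pow_mul]
    gcongr
  linarith

lemma InfinitelyDivisible.charFun_ne_zero (hμ : InfinitelyDivisible μ) (z : ℝ) :
    charFun μ z ≠ 0 := by
  have := hμ.1
  have hcont : Continuous (charFun μ) := continuous_charFun
  have hlim : Tendsto (fun n : ℕ ↦ charFun μ (z * (1 / 2) ^ n)) atTop (𝓝 (charFun μ 0)) := by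
    refine (hcont.tendsto 0).comp ?_
    simpa using (tendsto_pow_atTop_nhds_zero_of_lt_one (r := (1 / 2 : ℝ))
      (by norm_num) (by norm_num)).const_mul z
  have h1 : charFun μ 0 ≠ 0 := by simp
  -- Near `0` there is no zero; doubling `n` times carries this back to `z`.
  obtain ⟨n, hn⟩ := (hlim.eventually_ne h1).exists
  induction n with
  | zero => simpa using hn
  | succ n ih =>
    apply ih
    have := hμ.charFun_two_mul_ne_zero hn
    rwa [show 2 * (z * (1 / 2 : ℝ) ^ (n + 1)) = z * (1 / 2) ^ n by ring] at this

lemma InfinitelyDivisible.exists_isCharExponent (hμ : InfinitelyDivisible μ) :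
    ∃ φ, IsCharExponent μ φ := by
  have := hμ.1
  exact exists_continuous_log continuous_charFun (by simp) hμ.charFun_ne_zero

lemma IsCharExponent.re_nonpos [IsProbabilityMeasure μ] {φ : ℝ → ℂ} (hφ : IsCharExponent μ φ)
    (z : ℝ) : (φ z).re ≤ 0 := by
  have h := norm_charFun_le_one (μ := μ) (t := z)
  rwa [hφ.2.2, Complex.norm_exp, Real.exp_le_one_iff] at h

lemma InfinitelyDivisible.exists_charFun_eq_exp_div (hμ : InfinitelyDivisible μ) {φ : ℝ → ℂ}
    (hφ : IsCharExponent μ φ) (m n : ℕ) (hn : 1 ≤ n) :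
    ∃ κ : Measure ℝ, IsProbabilityMeasure κ ∧
      ∀ z, charFun κ z = Complex.exp (((m / n : ℝ) : ℂ) * φ z) := by
  obtain ⟨κ, hκ, hκn⟩ := hμ.2 n hn
  have hn0 : (n : ℂ) ≠ 0 := by exact_mod_cast (by omega : n ≠ 0)
  obtain ⟨ψ, hψc, hψ0, hψ⟩ := exists_continuous_log (g := charFun κ) continuous_charFun (by simp)
    fun z hz ↦ hμ.charFun_ne_zero z (by
      rw [← hκn, charFun_nFoldConv, hz, zero_pow (by omega)])
  -- Uniqueness of continuous logarithms removes the ambiguity in the choice of complex `n`-th root.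
  have key : (fun z ↦ (n : ℂ) * ψ z) = φ :=
    continuous_log_unique (by fun_prop) hφ.1 (by simp [hψ0, hφ.2.1]) fun z ↦ by
      rw [Complex.exp_nat_mul, ← hψ, ← hφ.2.2, ← hκn, charFun_nFoldConv]
  refine ⟨nFoldConv κ m, nFoldConv_isProbabilityMeasure κ m, fun z ↦ ?_⟩
  rw [charFun_nFoldConv, hψ, ← Complex.exp_nat_mul, ← key]
  congr 1
  push_cast
  field_simp

/-- Rational powers approximate `s`. Their characteristic functions converge to a function
continuous at `0`, so the laws are tight, and any weak cluster point has the desired characteristic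
function. -/
lemma InfinitelyDivisible.exists_charFun_eq_exp_mul (hμ : InfinitelyDivisible μ) {φ : ℝ → ℂ}
    (hφ : IsCharExponent μ φ) {s : ℝ} (hs : 0 ≤ s) :
    ∃ κ : Measure ℝ, IsProbabilityMeasure κ ∧ ∀ z, charFun κ z = Complex.exp ((s : ℂ) * φ z) := by
  choose κ hκ hκφ using fun k : ℕ ↦
    hμ.exists_charFun_eq_exp_div hφ ⌊s * ((k + 1 : ℕ) : ℝ)⌋₊ (k + 1) (by omega)
  have hq : Tendsto (fun k : ℕ ↦ ((⌊s * ((k + 1 : ℕ) : ℝ)⌋₊ : ℝ) / ((k + 1 : ℕ) : ℝ))) atTop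
      (𝓝 s) :=
    (tendsto_nat_floor_mul_div_atTop hs).comp
      (tendsto_natCast_atTop_atTop.comp (tendsto_add_atTop_nat 1))
  have hlim (z : ℝ) : Tendsto (fun k ↦ charFun (κ k) z) atTop
      (𝓝 (Complex.exp ((s : ℂ) * φ z))) := by
    simp_rw [hκφ]
    exact ((((Complex.continuous_ofReal.tendsto s).comp hq).mul_const (φ z)).cexp)
  have hφc := hφ.1
  have htight : IsTightMeasureSet (Set.range κ) :=
    isTightMeasureSet_of_tendsto_charFun (by fun_prop) hlim
  let P : ℕ → ProbabilityMeasure ℝ := fun k ↦ ⟨κ k, hκ k⟩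
  have hcomp : IsCompact (closure (Set.range P)) := by
    refine isCompact_closure_of_isTightMeasureSet ?_
    convert htight using 1
    ext ν
    constructor
    · rintro ⟨_, ⟨k, rfl⟩, rfl⟩
      exact ⟨k, rfl⟩
    · rintro ⟨k, rfl⟩
      exact ⟨P k, ⟨k, rfl⟩, rfl⟩
  -- An ultrafilter plays the role of a convergent subsequence.
  let U : Ultrafilter ℕ := Ultrafilter.of atTop
  have hU : (U : Filter ℕ) ≤ atTop := Ultrafilter.of_le _
  obtain ⟨ν, -, hν⟩ := hcomp.ultrafilter_le_nhds (U.map P)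
    (le_principal_iff.mpr (by
      refine mem_of_superset ?_ (subset_closure)
      exact Filter.mem_map.mpr (univ_mem' fun k ↦ Set.mem_range_self k)))
  have hν' : Tendsto P U (𝓝 ν) := hν
  refine ⟨ν, inferInstance, fun z ↦ ?_⟩
  refine tendsto_nhds_unique ?_ ((hlim z).mono_left hU)
  rw [ProbabilityMeasure.tendsto_iff_forall_integral_rclike_tendsto ℂ] at hν'
  simp_rw [charFun_eq_integral_innerProbChar]
  exact hν' (BoundedContinuousFunction.innerProbChar z)

end Exponent

/-! ### Measurability of the convolution semigroup -/

section ConvPow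

variable {μ : Measure ℝ} {φ : ℝ → ℂ}

lemma InfinitelyDivisible.isConvPow_convPow (hμ : InfinitelyDivisible μ) {s : ℝ} (hs : 0 ≤ s) :
    IsConvPow μ s (convPow μ s) := by
  obtain ⟨φ, hφ⟩ := hμ.exists_isCharExponent
  obtain ⟨κ, hκ, h⟩ := hμ.exists_charFun_eq_exp_mul hφ hs
  have hex : ∃ κ, IsConvPow μ s κ := ⟨κ, hκ, φ, hφ, h⟩
  rw [convPow, dif_pos hex]
  exact hex.choose_spec

lemma InfinitelyDivisible.charFun_convPow (hμ : InfinitelyDivisible μ) (hφ : IsCharExponent μ φ)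
    {s : ℝ} (hs : 0 ≤ s) (z : ℝ) : charFun (convPow μ s) z = Complex.exp ((s : ℂ) * φ z) := by
  obtain ⟨-, ψ, hψ, h⟩ := hμ.isConvPow_convPow hs
  rw [h, hφ.unique hψ]

/-- Lévy's continuity theorem makes the map weakly continuous, so masses of open sets are lower
semicontinuous in `s`. The maximum avoids negative times, where a convolution power need not exist.
-/
lemma InfinitelyDivisible.measurable_convPow_max (hμ : InfinitelyDivisible μ) :
    Measurable fun s : ℝ ↦ convPow μ (max s 0) := by
  obtain ⟨φ, hφ⟩ := hμ.exists_isCharExponent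
  have hprob (s : ℝ) : IsProbabilityMeasure (convPow μ (max s 0)) :=
    (hμ.isConvPow_convPow (le_max_right s 0)).1
  let P : ℝ → ProbabilityMeasure ℝ := fun s ↦ ⟨convPow μ (max s 0), hprob s⟩
  have hP : Continuous P := by
    refine continuous_iff_seqContinuous.mpr fun u s hu ↦ ?_
    refine ProbabilityMeasure.tendsto_of_tendsto_charFun fun z ↦ ?_
    have h (s : ℝ) : charFun (P s) z = Complex.exp (((max s 0 : ℝ) : ℂ) * φ z) :=
      hμ.charFun_convPow hφ (le_max_right _ _) z
    simp only [Function.comp_apply, h]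
    have hc : Continuous fun s : ℝ ↦ Complex.exp (((max s 0 : ℝ) : ℂ) * φ z) := by fun_prop
    exact (hc.tendsto s).comp hu
  refine Measurable.measure_of_isPiSystem_of_isProbabilityMeasure
    (S := {G : Set ℝ | IsOpen G}) (BorelSpace.measurable_eq) isPiSystem_isOpen fun G hG ↦ ?_
  refine LowerSemicontinuous.measurable fun s ↦ lowerSemicontinuousAt_iff_le_liminf.mpr ?_
  exact ProbabilityMeasure.le_liminf_measure_open_of_tendsto (hP.tendsto s) hG

lemma InfinitelyDivisible.aemeasurable_convPow (hμ : InfinitelyDivisible μ) {ρ : Measure ℝ}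
    (hρ : ρ (Set.Iic 0) = 0) : AEMeasurable (convPow μ) ρ := by
  refine ⟨_, hμ.measurable_convPow_max, ?_⟩
  filter_upwards [compl_mem_ae_iff.mpr hρ] with s hs
  rw [max_eq_left (le_of_lt (by simpa using hs))]

end ConvPow

/-! ### Truncated second moments and characteristic functions -/

section Truncation

lemma abs_sinc_le_of_abs_le_one {t : ℝ} (ht : |t| ≤ 1) : |Real.sinc t| ≤ 1 - 11 / 96 * t ^ 2 := by
  wlog h0 : 0 ≤ t generalizing t
  · have := this (t := -t) (by rwa [abs_neg]) (by linarith)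
    simpa using this
  rcases h0.eq_or_lt with rfl | hpos
  · simp
  have h1 : t ≤ 1 := (le_abs_self t).trans ht
  have hb := (abs_le.mp (Real.sin_bound ht)).2
  have hs : 0 ≤ Real.sin t :=
    Real.sin_nonneg_of_nonneg_of_le_pi h0 (by linarith [Real.pi_gt_three])
  rw [Real.sinc_of_ne_zero hpos.ne', abs_of_nonneg (by positivity), div_le_iff₀ hpos]
  rw [abs_of_pos hpos] at hb
  have h53 : t ^ 5 ≤ t ^ 3 := pow_le_pow_of_le_one h0 h1 (by norm_num)
  have h3 : 0 ≤ t ^ 3 := by positivity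
  linarith

/-- The right side is used because `1 - sinc x` is the mean of `1 - cos (z x)` over `z ∈ [-1, 1]`.
For `|x| ≤ 2`, `sinc x = sinc (x/2) cos (x/2)` reduces to arguments of size at most `1`, and `40 ·
(11/96) / 4 > 1`. -/
lemma min_one_sq_le_one_sub_sinc (x : ℝ) : min 1 (|x| ^ 2) ≤ 40 * (1 - Real.sinc x) := by
  rcases le_or_gt |x| 2 with hx | hx
  · have ht : |x / 2| ≤ 1 := by
      rw [abs_div, abs_of_pos (by norm_num : (0 : ℝ) < 2)]
      linarith
    have hsinc : Real.sinc x = Real.sinc (x / 2) * Real.cos (x / 2) := by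
      rcases eq_or_ne x 0 with rfl | h0
      · simp
      · rw [Real.sinc_of_ne_zero h0, Real.sinc_of_ne_zero (by positivity)]
        have := Real.sin_two_mul (x / 2)
        rw [mul_div_cancel₀ _ (by norm_num : (2 : ℝ) ≠ 0)] at this
        rw [this]
        field_simp
    have h1 : Real.sinc x ≤ 1 - 11 / 96 * (x / 2) ^ 2 := by
      refine (le_abs_self _).trans (le_trans ?_ (abs_sinc_le_of_abs_le_one ht))
      rw [hsinc, abs_mul]
      exact mul_le_of_le_one_right (abs_nonneg _) (Real.abs_cos_le_one _)
    refine (min_le_right _ _).trans ?_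
    rw [sq_abs]
    nlinarith [sq_nonneg x]
  · have h0 : x ≠ 0 := by
      rintro rfl
      norm_num at hx
    have h1 : Real.sinc x ≤ 1 / 2 := by
      refine (le_abs_self _).trans ?_
      rw [Real.sinc_of_ne_zero h0, abs_div, div_le_iff₀ (by positivity)]
      linarith [Real.abs_sin_le_one x]
    refine (min_le_left _ _).trans ?_
    linarith

lemma one_sub_cos_le_mul_min (z x : ℝ) :
    1 - Real.cos (z * x) ≤ (2 + z ^ 2) * min 1 (|x| ^ 2) := by
  rcases le_total 1 (|x| ^ 2) with h | h
  · rw [min_eq_left h]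
    nlinarith [Real.neg_one_le_cos (z * x), sq_nonneg z]
  · rw [min_eq_right h, sq_abs]
    nlinarith [Real.one_sub_sq_div_two_le_cos (x := z * x), sq_nonneg x, sq_nonneg (z * x)]

variable (κ : Measure ℝ) [IsProbabilityMeasure κ]

lemma integrable_min_one_sq : Integrable (fun x : ℝ ↦ min 1 (|x| ^ 2)) κ :=
  Integrable.of_bound (by fun_prop) 1 (ae_of_all _ fun x ↦ by
    rw [Real.norm_of_nonneg (by positivity)]
    exact min_le_left _ _)

lemma ofReal_integral_min_one_sq :
    ENNReal.ofReal (∫ x, min 1 (|x| ^ 2) ∂κ) = ∫⁻ x, ENNReal.ofReal (min 1 (|x| ^ 2)) ∂κ :=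
  ofReal_integral_eq_lintegral_ofReal (integrable_min_one_sq κ) (ae_of_all _ fun x ↦ by positivity)

lemma integral_min_one_sq_le {C : ℝ} (hC : ∀ z, |z| ≤ 1 → ‖1 - charFun κ z‖ ≤ C) :
    ∫ x, min 1 (|x| ^ 2) ∂κ ≤ 40 * C := by
  have hsinc : Integrable Real.sinc κ := Real.integrable_sinc
  have h1 : ∫ x, min 1 (|x| ^ 2) ∂κ ≤ ∫ x, 40 * (1 - Real.sinc x) ∂κ :=
    integral_mono (integrable_min_one_sq κ) (((integrable_const _).sub hsinc).const_mul _)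
      min_one_sq_le_one_sub_sinc
  have h2 : ((2 * (1 - ∫ x, Real.sinc x ∂κ) : ℝ) : ℂ) = ∫ t in (-1 : ℝ)..1, (1 - charFun κ t) := by
    rw [intervalIntegral.integral_sub (by simp) intervalIntegrable_charFun,
      integral_charFun_Icc one_pos]
    simp only [one_mul]
    push_cast
    simp
    ring
  have h3 : ‖∫ t in (-1 : ℝ)..1, (1 - charFun κ t)‖ ≤ C * |1 - (-1)| :=
    intervalIntegral.norm_integral_le_of_norm_le_const fun z hz ↦ hC z (by
      rw [Set.uIoc_of_le (by norm_num)] at hz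
      exact abs_le.mpr ⟨hz.1.le, hz.2⟩)
  rw [← h2, Complex.norm_real] at h3
  have h4 := (le_abs_self _).trans h3
  norm_num at h4
  rw [integral_const_mul, integral_sub (integrable_const _) hsinc] at h1
  simp only [integral_const, probReal_univ, smul_eq_mul, mul_one] at h1
  linarith

lemma one_sub_re_charFun_le (z : ℝ) :
    1 - (charFun κ z).re ≤ (2 + z ^ 2) * ∫ x, min 1 (|x| ^ 2) ∂κ := by
  rw [one_sub_re_charFun, ← integral_const_mul]
  exact integral_mono ((integrable_const _).sub (integrable_cos_mul κ z))
    ((integrable_min_one_sq κ).const_mul _) (one_sub_cos_le_mul_min z)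

lemma integral_min_one_sq_le_one : ∫ x, min 1 (|x| ^ 2) ∂κ ≤ 1 := by
  have := integral_mono (integrable_min_one_sq κ) (integrable_const 1)
    fun x : ℝ ↦ min_le_left 1 (|x| ^ 2)
  simpa using this

lemma div_one_add_le_one_sub_exp_neg {t : ℝ} (ht : 0 ≤ t) : t / (1 + t) ≤ 1 - Real.exp (-t) := by
  have h : Real.exp (-t) ≤ (1 + t)⁻¹ := by
    rw [Real.exp_neg]
    exact inv_anti₀ (by positivity) (by linarith [Real.add_one_le_exp t])
  have : t / (1 + t) = 1 - (1 + t)⁻¹ := by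
    field_simp
    ring
  linarith

lemma norm_one_sub_exp_le {w : ℂ} (hw : w.re ≤ 0) : ‖1 - Complex.exp w‖ ≤ 2 * ‖w‖ := by
  rcases le_total ‖w‖ 1 with h | h
  · rw [norm_sub_rev]
    exact Complex.norm_exp_sub_one_le h
  · calc ‖1 - Complex.exp w‖ ≤ ‖(1 : ℂ)‖ + ‖Complex.exp w‖ := norm_sub_le _ _
      _ ≤ 1 + 1 := by
        rw [norm_one, Complex.norm_exp]
        gcongr
        exact Real.exp_le_one_iff.mpr hw
      _ ≤ 2 * ‖w‖ := by linarith

end Truncation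

/-! ### The Lévy domain -/

section Mixing

variable {μ ρ : Measure ℝ}

/-- By Markov's inequality the sets where `1 ∧ x²` is at least `1/(n+1)` have finite mass; they
exhaust the complement of the null set `{0}`. -/
lemma sigmaFinite_of_lintegral_min_one_sq_lt_top {ν : Measure ℝ} (h0 : ν {0} = 0)
    (h : ∫⁻ x, ENNReal.ofReal (min 1 (|x| ^ 2)) ∂ν < ⊤) : SigmaFinite ν := by
  have hm : Measurable fun x : ℝ ↦ ENNReal.ofReal (min 1 (|x| ^ 2)) := by fun_prop
  refine ⟨⟨⟨fun n ↦ {0} ∪ {x | ((n : ENNReal) + 1)⁻¹ ≤ ENNReal.ofReal (min 1 (|x| ^ 2))},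
    fun _ ↦ trivial, fun n ↦ ?_, ?_⟩⟩⟩
  · refine (measure_union_le _ _).trans_lt ?_
    rw [h0, zero_add]
    exact (meas_ge_le_lintegral_div hm.aemeasurable (by simp) (by simp)).trans_lt
      (ENNReal.div_lt_top h.ne (by simp))
  · refine Set.eq_univ_of_forall fun x ↦ Set.mem_iUnion.mpr ?_
    rcases eq_or_ne x 0 with rfl | hx
    · exact ⟨0, Or.inl rfl⟩
    · have hpos : ENNReal.ofReal (min 1 (|x| ^ 2)) ≠ 0 := by
        have : 0 < |x| := abs_pos.mpr hx
        simpa using hx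
      obtain ⟨n, hn⟩ := ENNReal.exists_inv_nat_lt hpos
      refine ⟨n, Or.inr (le_trans ?_ hn.le)⟩
      exact ENNReal.inv_le_inv.mpr le_self_add

lemma InfinitelyDivisible.mixing_apply (hμ : InfinitelyDivisible μ) (hρ : ρ (Set.Iic 0) = 0)
    {A : Set ℝ} (hA : MeasurableSet A) (h0 : (0 : ℝ) ∉ A) :
    mixing μ ρ A = ∫⁻ s, convPow μ s A ∂ρ := by
  rw [mixing, Measure.restrict_apply hA, Set.inter_eq_left.mpr (Set.subset_compl_singleton_iff.mpr h0),
    Measure.bind_apply hA (hμ.aemeasurable_convPow hρ)]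

lemma InfinitelyDivisible.lintegral_mixing (hμ : InfinitelyDivisible μ)
    (hρ : ρ (Set.Iic 0) = 0) :
    ∫⁻ x, ENNReal.ofReal (min 1 (|x| ^ 2)) ∂(mixing μ ρ) =
      ∫⁻ s, ∫⁻ x, ENNReal.ofReal (min 1 (|x| ^ 2)) ∂(convPow μ s) ∂ρ := by
  rw [mixing, ← lintegral_indicator (by measurability), Set.indicator_eq_self.mpr,
    Measure.lintegral_bind (hμ.aemeasurable_convPow hρ) (by fun_prop)]
  intro x hx h
  rw [Set.mem_singleton_iff] at h
  simp [h] at hx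

lemma mixing_singleton_zero : mixing μ ρ {0} = 0 := by
  rw [mixing, Measure.restrict_apply (by measurability)]
  simp

lemma InfinitelyDivisible.exists_min_one_le (hμ : InfinitelyDivisible μ)
    (hd : ¬ ∃ a : ℝ, μ = Measure.dirac a) :
    ∃ K : ℝ, 0 ≤ K ∧ ∀ s : ℝ, 0 < s → min 1 |s| ≤ K * ∫ x, min 1 (|x| ^ 2) ∂(convPow μ s) := by
  have := hμ.1
  obtain ⟨φ, hφ⟩ := hμ.exists_isCharExponent
  obtain ⟨z, hz⟩ : ∃ z, (φ z).re < 0 := by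
    by_contra! h
    refine hd (exists_eq_dirac_of_norm_charFun_eq_one μ fun z ↦ ?_)
    rw [hφ.2.2, Complex.norm_exp, le_antisymm (hφ.re_nonpos z) (h z), Real.exp_zero]
  obtain ⟨c, hc⟩ : ∃ c, c = -(φ z).re := ⟨_, rfl⟩
  have hc0 : 0 < c := by linarith
  refine ⟨(1 + c) / c * (2 + z ^ 2), by positivity, fun s hs ↦ ?_⟩
  have := (hμ.isConvPow_convPow hs.le).1
  have h1 := one_sub_re_charFun_le (convPow μ s) z
  have h2 : (charFun (convPow μ s) z).re ≤ Real.exp (-(s * c)) := by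
    refine (Complex.re_le_norm _).trans ?_
    rw [hμ.charFun_convPow hφ hs.le, Complex.norm_exp, Complex.re_ofReal_mul, hc]
    simp
  have h3 := div_one_add_le_one_sub_exp_neg (t := s * c) (by positivity)
  -- For `s ≥ 1` use that `t / (1 + t)` increases; for `s ≤ 1` use `1 + s c ≤ 1 + c`.
  have h4 : min 1 |s| * (c / (1 + c)) ≤ s * c / (1 + s * c) := by
    rw [abs_of_pos hs, ← mul_div_assoc, div_le_div_iff₀ (by positivity) (by positivity)]
    rcases le_total 1 s with h | h
    · rw [min_eq_left h]
      nlinarith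
    · rw [min_eq_right h]
      have : s * c * (s * c) ≤ s * c * c :=
        mul_le_mul_of_nonneg_left (by nlinarith) (by positivity)
      nlinarith
  have h5 : min 1 |s| * (c / (1 + c)) ≤ (2 + z ^ 2) * ∫ x, min 1 (|x| ^ 2) ∂(convPow μ s) := by
    linarith
  calc min 1 |s| = (1 + c) / c * (min 1 |s| * (c / (1 + c))) := by field_simp
    _ ≤ (1 + c) / c * ((2 + z ^ 2) * ∫ x, min 1 (|x| ^ 2) ∂(convPow μ s)) := by gcongr
    _ = _ := by ring

lemma InfinitelyDivisible.exists_integral_min_one_sq_le (hμ : InfinitelyDivisible μ) :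
    ∃ K : ℝ, 0 ≤ K ∧ ∀ s : ℝ, 0 < s → ∫ x, min 1 (|x| ^ 2) ∂(convPow μ s) ≤ K * min 1 |s| := by
  have := hμ.1
  obtain ⟨φ, hφ⟩ := hμ.exists_isCharExponent
  obtain ⟨M, hM⟩ := (isCompact_Icc (a := (-1 : ℝ)) (b := 1)).exists_bound_of_continuousOn
    hφ.1.continuousOn
  have hM0 : 0 ≤ M := (norm_nonneg _).trans (hM 0 (by norm_num))
  -- The term `80 * M` serves `s ≤ 1`, as `40 · 2sM`; the term `1` serves `s ≥ 1`, where the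
  -- integral is at most `1`.
  refine ⟨80 * M + 1, by positivity, fun s hs ↦ ?_⟩
  have := (hμ.isConvPow_convPow hs.le).1
  rw [abs_of_pos hs]
  rcases le_total 1 s with h | h
  · rw [min_eq_left h]
    linarith [integral_min_one_sq_le_one (convPow μ s)]
  · rw [min_eq_right h]
    have := integral_min_one_sq_le (convPow μ s) (C := 2 * (s * M)) fun z hz ↦ by
      rw [hμ.charFun_convPow hφ hs.le]
      refine (norm_one_sub_exp_le ?_).trans ?_
      · rw [Complex.re_ofReal_mul]
        exact mul_nonpos_of_nonneg_of_nonpos hs.le (hφ.re_nonpos z)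
      · rw [norm_mul, Complex.norm_real, Real.norm_of_nonneg hs.le]
        gcongr
        exact hM z (abs_le.mp hz)
    nlinarith

lemma ae_pos_of_measure_Iic_eq_zero (hρ : ρ (Set.Iic 0) = 0) : ∀ᵐ s ∂ρ, 0 < s := by
  filter_upwards [compl_mem_ae_iff.mpr hρ] with s hs
  simpa using hs

theorem InfinitelyDivisible.levyDomain_eq (hμ : InfinitelyDivisible μ)
    (hd : ¬ ∃ a : ℝ, μ = Measure.dirac a) : levyDomain μ = levyMeasuresPosOne := by
  ext ρ
  refine and_congr_right fun ⟨hL, hρ⟩ ↦ ⟨fun h ↦ ?_, fun h ↦ ?_⟩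
  · obtain ⟨K, hK0, hK⟩ := hμ.exists_min_one_le hd
    have hlt := h.lintegral_lt_top
    rw [hμ.lintegral_mixing hρ] at hlt
    refine lt_of_le_of_lt ?_ (ENNReal.mul_lt_top (ENNReal.ofReal_lt_top (r := K)) hlt)
    rw [← lintegral_const_mul' _ _ ENNReal.ofReal_ne_top]
    refine lintegral_mono_ae ?_
    filter_upwards [ae_pos_of_measure_Iic_eq_zero hρ] with s hs
    have := (hμ.isConvPow_convPow hs.le).1
    rw [← ofReal_integral_min_one_sq, ← ENNReal.ofReal_mul hK0]
    exact ENNReal.ofReal_le_ofReal (hK s hs)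
  · obtain ⟨K, hK0, hK⟩ := hμ.exists_integral_min_one_sq_le
    have hlt : ∫⁻ x, ENNReal.ofReal (min 1 (|x| ^ 2)) ∂(mixing μ ρ) < ⊤ := by
      rw [hμ.lintegral_mixing hρ]
      refine lt_of_le_of_lt ?_ (ENNReal.mul_lt_top (ENNReal.ofReal_lt_top (r := K)) h)
      rw [← lintegral_const_mul' _ _ ENNReal.ofReal_ne_top]
      refine lintegral_mono_ae ?_
      filter_upwards [ae_pos_of_measure_Iic_eq_zero hρ] with s hs
      have := (hμ.isConvPow_convPow hs.le).1
      rw [← ofReal_integral_min_one_sq, ← ENNReal.ofReal_mul hK0]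
      exact ENNReal.ofReal_le_ofReal (hK s hs)
    exact ⟨sigmaFinite_of_lintegral_min_one_sq_lt_top mixing_singleton_zero hlt,
      mixing_singleton_zero, hlt⟩

end Mixing

/-! ### The Lévy range -/

section Range

variable {μ : Measure ℝ}

lemma measure_eq_zero_of_conv_self_eq_zero {κ : Measure ℝ} [SFinite κ] {A B : Set ℝ}
    (hA : MeasurableSet A) (hAB : ∀ x ∈ B, ∀ y ∈ B, x + y ∈ A)
    (h : Measure.conv κ κ A = 0) : κ B = 0 := by
  rw [Measure.conv, Measure.map_apply measurable_add hA] at h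
  have := measure_mono_null (s := B ×ˢ B) (fun p hp ↦ hAB p.1 hp.1 p.2 hp.2) h
  rw [Measure.prod_prod] at this
  simpa using this

/-- Two points of the same sign beyond `r/2` add up to a point beyond `r`, so each sign is treated
separately to avoid cancellation. -/
lemma measure_lt_abs_eq_zero_of_conv_self {κ : Measure ℝ} [SFinite κ] {r : ℝ}
    (h : Measure.conv κ κ {x | r < |x|} = 0) : κ {x | r / 2 < |x|} = 0 := by
  have hA : MeasurableSet {x : ℝ | r < |x|} := measurableSet_lt (by fun_prop) (by fun_prop)
  have h1 : κ {x | r / 2 < x} = 0 := measure_eq_zero_of_conv_self_eq_zero hA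
    (fun x hx y hy ↦ by
      simp only [Set.mem_ofPred_eq] at hx hy ⊢
      exact lt_abs.mpr (Or.inl (by linarith))) h
  have h2 : κ {x | x < -(r / 2)} = 0 := measure_eq_zero_of_conv_self_eq_zero hA
    (fun x hx y hy ↦ by
      simp only [Set.mem_ofPred_eq] at hx hy ⊢
      exact lt_abs.mpr (Or.inr (by linarith))) h
  refine measure_mono_null (fun x hx ↦ ?_) (measure_union_null h1 h2)
  rw [Set.mem_ofPred_eq] at hx
  rcases lt_abs.mp hx with h | h
  · exact Or.inl h
  · exact Or.inr (lt_neg_of_lt_neg h)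

lemma InfinitelyDivisible.convPow_two_mul (hμ : InfinitelyDivisible μ) {s : ℝ} (hs : 0 ≤ s) :
    convPow μ (2 * s) = Measure.conv (convPow μ s) (convPow μ s) := by
  obtain ⟨φ, hφ⟩ := hμ.exists_isCharExponent
  have := (hμ.isConvPow_convPow hs).1
  have := (hμ.isConvPow_convPow (mul_nonneg zero_le_two hs)).1
  refine Measure.ext_of_charFun (funext fun z ↦ ?_)
  rw [charFun_conv, hμ.charFun_convPow hφ hs, hμ.charFun_convPow hφ (by positivity),
    ← Complex.exp_add]
  congr 1
  push_cast
  ring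

lemma one_sub_re_charFun_le_of_abs_le {κ : Measure ℝ} [IsProbabilityMeasure κ] {r : ℝ}
    (h : κ {x | r < |x|} = 0) (z : ℝ) : 1 - (charFun κ z).re ≤ z ^ 2 * r ^ 2 := by
  rw [one_sub_re_charFun]
  have : ∫ x, (1 - Real.cos (z * x)) ∂κ ≤ ∫ _, z ^ 2 * r ^ 2 ∂κ := by
    refine integral_mono_ae ((integrable_const _).sub (integrable_cos_mul κ z))
      (integrable_const _) ?_
    filter_upwards [compl_mem_ae_iff.mpr h] with x hx
    have hx' : |x| ≤ r := by simpa using hx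
    have : x ^ 2 ≤ r ^ 2 := by
      rw [← sq_abs]
      gcongr
    have h1 := Real.one_sub_sq_div_two_le_cos (x := z * x)
    have h2 : z ^ 2 * x ^ 2 ≤ z ^ 2 * r ^ 2 := by gcongr
    nlinarith [sq_nonneg (z * x)]
  simpa using this

/-- A convolution power with bounded support is concentrated at a point, and so is `μ`. -/
lemma InfinitelyDivisible.eq_dirac_of_bounded_convPow (hμ : InfinitelyDivisible μ) {s : ℝ}
    (hs : 0 < s) (h : convPow μ s {x | 1 < |x|} = 0) : ∃ a : ℝ, μ = Measure.dirac a := by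
  have := hμ.1
  obtain ⟨φ, hφ⟩ := hμ.exists_isCharExponent
  -- Halving the time halves the radius of the support.
  have hsupp (k : ℕ) : convPow μ (s * (1 / 2) ^ k) {x | (1 / 2 : ℝ) ^ k < |x|} = 0 := by
    induction k with
    | zero => simpa using h
    | succ k ih =>
      have hk : 0 ≤ s * (1 / 2) ^ (k + 1) := by positivity
      have := (hμ.isConvPow_convPow hk).1
      rw [show s * (1 / 2 : ℝ) ^ k = 2 * (s * (1 / 2) ^ (k + 1)) by ring,
        hμ.convPow_two_mul hk] at ih
      have hhalf := measure_lt_abs_eq_zero_of_conv_self ih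
      rwa [show (1 / 2 : ℝ) ^ k / 2 = (1 / 2) ^ (k + 1) by ring] at hhalf
  refine exists_eq_dirac_of_norm_charFun_eq_one μ fun z ↦ ?_
  obtain ⟨r, hr⟩ : ∃ r, r = -(s * (φ z).re) := ⟨_, rfl⟩
  have hr0 : 0 ≤ r := by
    rw [hr, neg_nonneg]
    exact mul_nonpos_of_nonneg_of_nonpos hs.le (hφ.re_nonpos z)
  -- At time `s e`, with `e = 2^{-k}`, the quantity `1 - Re charFun` is at most `z² e²` by the
  -- support bound, but at least `r e / (1 + r e)`, which is linear in `e`. As `e → 0` this forces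
  -- `r = 0`.
  have hbound (k : ℕ) : r ≤ z ^ 2 * (1 + r) * (1 / 2) ^ k := by
    obtain ⟨e, he⟩ : ∃ e : ℝ, e = (1 / 2) ^ k := ⟨_, rfl⟩
    have he0 : 0 < e := by rw [he]; positivity
    have he1 : e ≤ 1 := by
      rw [he]
      exact pow_le_one₀ (by norm_num) (by norm_num)
    have hk : 0 ≤ s * e := by positivity
    have := (hμ.isConvPow_convPow hk).1
    have h1 := one_sub_re_charFun_le_of_abs_le (he ▸ hsupp k) z
    have h2 : (charFun (convPow μ (s * e)) z).re ≤ Real.exp (-(r * e)) := by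
      refine (Complex.re_le_norm _).trans ?_
      rw [hμ.charFun_convPow hφ hk, Complex.norm_exp, Complex.re_ofReal_mul, hr]
      refine le_of_eq ?_
      congr 1
      ring
    have h3 := div_one_add_le_one_sub_exp_neg (t := r * e) (by positivity)
    have h4 : r * e / (1 + r * e) ≤ z ^ 2 * e ^ 2 := by linarith
    rw [div_le_iff₀ (by positivity)] at h4
    have h5 : r ≤ z ^ 2 * e * (1 + r * e) := by
      refine le_of_mul_le_mul_right ?_ he0
      linarith
    refine h5.trans ?_
    rw [← he, mul_right_comm]
    gcongr
    nlinarith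
  have hlim : Tendsto (fun k : ℕ ↦ z ^ 2 * (1 + r) * (1 / 2) ^ k) atTop (𝓝 0) := by
    simpa using (tendsto_pow_atTop_nhds_zero_of_lt_one (r := (1 / 2 : ℝ))
      (by norm_num) (by norm_num)).const_mul (z ^ 2 * (1 + r))
  have hr1 : r ≤ 0 := ge_of_tendsto' hlim hbound
  have hre : (φ z).re = 0 := by
    refine le_antisymm (hφ.re_nonpos z) ?_
    by_contra! hneg
    nlinarith
  rw [hφ.2.2, Complex.norm_exp, hre, Real.exp_zero]

lemma convPow_dirac {a : ℝ} (hμ : InfinitelyDivisible (Measure.dirac a)) {s : ℝ} (hs : 0 ≤ s) :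
    convPow (Measure.dirac a) s = Measure.dirac (s * a) := by
  have := (hμ.isConvPow_convPow hs).1
  have hφ : IsCharExponent (Measure.dirac a) fun z ↦ z * a * Complex.I := by
    refine ⟨by fun_prop, by simp, fun z ↦ ?_⟩
    rw [charFun_dirac]
    simp [mul_comm]
  refine Measure.ext_of_charFun (funext fun z ↦ ?_)
  rw [hμ.charFun_convPow hφ hs, charFun_dirac]
  congr 1
  simp
  ring

lemma isLevyMeasure_dirac_add_dirac :
    IsLevyMeasure (Measure.dirac (1 : ℝ) + Measure.dirac (-1)) := by
  refine ⟨inferInstance, by simp, ?_⟩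
  rw [lintegral_add_measure, lintegral_dirac, lintegral_dirac]
  simp

lemma InfinitelyDivisible.dirac_add_dirac_notMem_levyRange (hμ : InfinitelyDivisible μ) :
    Measure.dirac (1 : ℝ) + Measure.dirac (-1) ∉ levyRange μ := by
  rintro ⟨ρ, ⟨⟨-, hρ⟩, -⟩, h⟩
  have hpos := ae_pos_of_measure_Iic_eq_zero hρ
  have hmeas : MeasurableSet {x : ℝ | 1 < |x|} := measurableSet_lt (by fun_prop) (by fun_prop)
  have hfar := hμ.mixing_apply hρ hmeas (by simp)
  have hleft := hμ.mixing_apply hρ (measurableSet_Iio (a := (0 : ℝ))) (by simp)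
  have hright := hμ.mixing_apply hρ (measurableSet_Ioi (a := (0 : ℝ))) (by simp)
  rw [h] at hfar hleft hright
  have hρ0 : ρ ≠ 0 := by
    rintro rfl
    simp at hright
  have : (ae ρ).NeBot := ae_neBot.mpr hρ0
  have hae : ∀ᵐ s ∂ρ, convPow μ s {x | 1 < |x|} = 0 := by
    have hm := ((Measure.measurable_coe hmeas).comp_aemeasurable (hμ.aemeasurable_convPow hρ))
    rw [Measure.add_apply, Measure.dirac_apply' _ hmeas, Measure.dirac_apply' _ hmeas] at hfar
    have h0 : ∫⁻ s, convPow μ s {x | 1 < |x|} ∂ρ = 0 := by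
      rw [← hfar]
      simp
    exact (lintegral_eq_zero_iff' hm).mp h0
  obtain ⟨s, hs, hs0⟩ := (hpos.and hae).exists
  obtain ⟨a, rfl⟩ := hμ.eq_dirac_of_bounded_convPow hs hs0
  -- The sign of `a` decides which half-line receives no mass, whereas `δ₁ + δ₋₁` charges both.
  rcases le_total 0 a with ha | ha
  · rw [lintegral_congr_ae (g := fun _ ↦ 0), lintegral_zero] at hleft
    · simp at hleft
    · filter_upwards [hpos] with s hs
      rw [convPow_dirac hμ hs.le, Measure.dirac_apply' _ measurableSet_Iio]
      simp [mul_nonneg hs.le ha]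
  · rw [lintegral_congr_ae (g := fun _ ↦ 0), lintegral_zero] at hright
    · simp at hright
    · filter_upwards [hpos] with s hs
      rw [convPow_dirac hμ hs.le, Measure.dirac_apply' _ measurableSet_Ioi]
      simp [mul_nonpos_of_nonneg_of_nonpos hs.le ha]

theorem InfinitelyDivisible.levyRange_ssubset (hμ : InfinitelyDivisible μ) :
    levyRange μ ⊂ levyMeasures := by
  refine (Set.ssubset_iff_of_subset ?_).mpr
    ⟨_, isLevyMeasure_dirac_add_dirac, hμ.dirac_add_dirac_notMem_levyRange⟩
  rintro _ ⟨ρ, hρ, rfl⟩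
  exact hρ.2

end Range

end LevyMixing

theorem mainTheorem9 (μ : MeasureTheory.Measure ℝ) (hμ : LevyMixing.InfinitelyDivisible μ) :
    ((¬ ∃ a : ℝ, μ = MeasureTheory.Measure.dirac a) →
        LevyMixing.levyDomain μ = LevyMixing.levyMeasuresPosOne) ∧
      LevyMixing.levyRange μ ⊂ LevyMixing.levyMeasures :=
  ⟨hμ.levyDomain_eq, hμ.levyRange_ssubset⟩
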